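/- Let $k$ be a field, let $Y$, $Z$, $X_n$ ($n\ge 1$), $T_n$ ($n\ge1$) be independent indeterminates over $k$, put $A=k[Y,Z,X_n,T_n : n\ge 1]$ and let $K$ be the field of fractions of $A$. Let $S$ be the monoid of all monomials $f$ of $A$ (including $1$) such that (a) if $Z$ occurs in $f$, then some $X_n$ occurs in $f$; (b) for all $n\ge 1$, if $T_n$ occurs in $f$, then $Y$ occurs in $f$ or some $X_i$ with $i\le n$ occurs in $f$. Let $R=k[S]\subseteq A$ be the $k$-span of $S$ (its field of fractions is $K$), let $P=(X_n : n\ge 1)A\cap R$, and let $M$ be the ideal of $R$ generated by $S\setminus\{1\}$. For nonzero fractional ideals $I,J$ of $R$ put $(J:I)=\{x\in K : xI\subseteq J\}$, $I_v=(R:(R:I))$ and $I_t=\bigcup J_v$, the union being over all nonzero finitely generated fractional ideals $J\subseteq I$. A nonzero fractional ideal $I$ is called divisorial if $I=I_v$, a $t$-ideal if $I=I_t$, and strong if $(R:I)=(I:I)$. A maximal divisorial ideal (respectively, a $t$-maximal ideal) is an ideal that is maximal among the divisorial ideals (respectively, the $t$-ideals) properly contained in $R$. Then: 1. $R$ is integrally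 closed. 2. $P=RZ^{-1}\cap R$. 3. $(R:P)=R[Z]$. 4. $P$ is strong and is a maximal divisorial ideal of $R$. 5. $M$ is a maximal ideal of $R$ and a $t$-ideal, and $P\subsetneq M$; in particular $P$ is not $t$-maximal. -/

import Mathlib

open scoped nonZeroDivisors

namespace StarOperation

section Definitions

variable {R : Type*} [CommRing R] [IsDomain R] {K : Type*} [Field K] [Algebra R K]
  [IsFractionRing R K]

/-- The `v`-closure `I_v = (R : (R : I))` of a nonzero fractional ideal `I`; the quotient
`J / I` of fractional ideals is `(J : I) = {x ∈ K | x I ⊆ J}` and `1` is `R` itself. -/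
noncomputable def vClosure (I : FractionalIdeal R⁰ K) : FractionalIdeal R⁰ K :=
  1 / (1 / I)

/-- The `t`-closure `I_t = ⋃ J_v`, the union over all nonzero finitely generated
fractional ideals `J` contained in `I`. -/
def tClosure (I : FractionalIdeal R⁰ K) : Set K :=
  {x | ∃ J : FractionalIdeal R⁰ K,
    J ≠ 0 ∧ (J : Submodule R K).FG ∧ J ≤ I ∧ x ∈ vClosure J}

/-- A divisorial ideal (a `v`-ideal): a nonzero fractional ideal with `I_v = I`. -/
def IsDivisorial (I : FractionalIdeal R⁰ K) : Prop :=
  I ≠ 0 ∧ vClosure I = I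

/-- A `t`-ideal: a nonzero fractional ideal with `I_t = I`. -/
def IsTIdeal (I : FractionalIdeal R⁰ K) : Prop :=
  I ≠ 0 ∧ tClosure I = {x : K | x ∈ I}

/-- A strong ideal: a nonzero fractional ideal with `(R : I) = (I : I)`. -/
def IsStrong (I : FractionalIdeal R⁰ K) : Prop :=
  I ≠ 0 ∧ 1 / I = I / I

end Definitions

section Maximal

variable {R : Type*} [CommRing R] [IsDomain R] (K : Type*) [Field K] [Algebra R K]
  [IsFractionRing R K]

/-- A maximal divisorial ideal: maximal among the proper integral divisorial ideals. -/
def IsMaximalDivisorial (P : Ideal R) : Prop :=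
  Maximal (fun I : Ideal R => I ≠ ⊤ ∧ IsDivisorial (I : FractionalIdeal R⁰ K)) P

/-- A `t`-maximal ideal: maximal among the proper integral `t`-ideals. -/
def IsTMaximal (P : Ideal R) : Prop :=
  Maximal (fun I : Ideal R => I ≠ ⊤ ∧ IsTIdeal (I : FractionalIdeal R⁰ K)) P

end Maximal

end StarOperation

namespace MonomialExample

/-- The indeterminates `Y`, `Z`, `X_n` and `T_n` for `n ≥ 1`. -/
inductive Var : Type
  | Y : Var
  | Z : Var
  | X (n : ℕ+) : Var
  | T (n : ℕ+) : Var

/-- The monoid `S` of monomials, written through their exponent vectors. The variable `v`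
occurs in the monomial `f` when its exponent `f v` is nonzero. -/
def S : AddSubmonoid (Var →₀ ℕ) where
  carrier := {f |
    (f Var.Z ≠ 0 → ∃ n, f (Var.X n) ≠ 0) ∧
    ∀ n, f (Var.T n) ≠ 0 → f Var.Y ≠ 0 ∨ ∃ i, i ≤ n ∧ f (Var.X i) ≠ 0}
  zero_mem' := by simp
  add_mem' := by
    rintro f g ⟨hf, hf'⟩ ⟨hg, hg'⟩
    have key : ∀ v, (f + g) v ≠ 0 ↔ f v ≠ 0 ∨ g v ≠ 0 := by
      intro v
      rw [Finsupp.add_apply]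
      omega
    refine ⟨fun h => ?_, fun n h => ?_⟩
    · rcases (key _).1 h with h | h
      · obtain ⟨n, hn⟩ := hf h
        exact ⟨n, (key _).2 (Or.inl hn)⟩
      · obtain ⟨n, hn⟩ := hg h
        exact ⟨n, (key _).2 (Or.inr hn)⟩
    · rcases (key _).1 h with h | h
      · rcases hf' n h with h1 | ⟨i, hi, h1⟩
        · exact Or.inl ((key _).2 (Or.inl h1))
        · exact Or.inr ⟨i, hi, (key _).2 (Or.inl h1)⟩
      · rcases hg' n h with h1 | ⟨i, hi, h1⟩
        · exact Or.inl ((key _).2 (Or.inr h1))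
        · exact Or.inr ⟨i, hi, (key _).2 (Or.inr h1)⟩

variable (k : Type*) [Field k]

/-- The semigroup ring `R = k[S]`: the polynomials over `k` all of whose monomials are
in `S`, that is, the `k`-span of `S`. -/
noncomputable def R : Subalgebra k (MvPolynomial Var k) where
  carrier := {p | ∀ m ∈ p.support, m ∈ S}
  mul_mem' := by
    classical
    intro p q hp hq m hm
    obtain ⟨a, ha, b, hb, rfl⟩ := Finset.mem_add.1 (MvPolynomial.support_mul p q hm)
    exact S.add_mem (hp a ha) (hq b hb)
  add_mem' := by
    classical
    intro p q hp hq m hm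
    rcases Finset.mem_union.1 (MvPolynomial.support_add hm) with h | h
    · exact hp m h
    · exact hq m h
  algebraMap_mem' := by
    classical
    intro c m hm
    rw [MvPolynomial.algebraMap_eq, MvPolynomial.mem_support_iff, MvPolynomial.coeff_C] at hm
    have h0 : m = 0 := by
      by_contra h
      exact hm (if_neg (fun h' => h h'.symm))
    rw [h0]
    exact S.zero_mem

/-- The monomial ideal `P = (X_n : n ≥ 1) k[Y, Z, X, T] ∩ R`. -/
noncomputable def P : Ideal (R k) :=
  (Ideal.span (Set.range fun n : ℕ+ => (MvPolynomial.X (Var.X n) : MvPolynomial Var k))).comap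
    (R k).val

/-- The ideal `M` of `R` generated by the monomials `s ≠ 1` of `S`. -/
noncomputable def M : Ideal (R k) :=
  Ideal.span {p | ∃ s : Var →₀ ℕ, s ∈ S ∧ s ≠ 0 ∧
    (p : MvPolynomial Var k) = MvPolynomial.monomial s 1}

/-- For every polynomial `p` there is a nonzero `d ∈ R` with `d p ∈ R`
(take `d = X_1`). -/
theorem X_one_mul_mem (p : MvPolynomial Var k) :
    MvPolynomial.X (Var.X 1) * p ∈ R k := by
  classical
  intro m hm
  rw [MvPolynomial.support_X_mul, Finset.mem_map] at hm
  obtain ⟨a, -, rfl⟩ := hm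
  have h : (Finsupp.single (Var.X 1) 1 + a : Var →₀ ℕ) (Var.X 1) ≠ 0 := by
    simp
  exact ⟨fun _ => ⟨1, h⟩, fun n _ => Or.inr ⟨1, one_le, h⟩⟩

theorem algebraMap_injective_R (K : Type*) [Field K] [Algebra (MvPolynomial Var k) K]
    [IsFractionRing (MvPolynomial Var k) K] :
    Function.Injective (algebraMap (R k) K) := fun _ _ hab =>
  Subtype.ext (IsFractionRing.injective (MvPolynomial Var k) K hab)

theorem exists_div_R (K : Type*) [Field K] [Algebra (MvPolynomial Var k) K]
    [IsFractionRing (MvPolynomial Var k) K] (w : K) :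
    ∃ x y : R k, w = algebraMap (R k) K x / algebraMap (R k) K y := by
  obtain ⟨a, b, -, rfl⟩ := IsFractionRing.div_surjective (A := MvPolynomial Var k) w
  have hX : algebraMap (MvPolynomial Var k) K (MvPolynomial.X (Var.X 1)) ≠ 0 := fun h =>
    MvPolynomial.X_ne_zero (R := k) (Var.X 1)
      (IsFractionRing.injective (MvPolynomial Var k) K (h.trans (map_zero _).symm))
  refine ⟨⟨MvPolynomial.X (Var.X 1) * a, X_one_mul_mem k a⟩,
    ⟨MvPolynomial.X (Var.X 1) * b, X_one_mul_mem k b⟩, ?_⟩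
  have e : ∀ p : MvPolynomial Var k,
      algebraMap (R k) K ⟨MvPolynomial.X (Var.X 1) * p, X_one_mul_mem k p⟩ =
        algebraMap (MvPolynomial Var k) K (MvPolynomial.X (Var.X 1) * p) := fun p => rfl
  rw [e a, e b, map_mul, map_mul]
  exact (mul_div_mul_left _ _ hX).symm

/-- The quotient field of `R` is the field of rational functions in all the variables. -/
instance isFractionRing_R (K : Type*) [Field K] [Algebra (MvPolynomial Var k) K]
    [IsFractionRing (MvPolynomial Var k) K] : IsFractionRing (R k) K := by
  have : FaithfulSMul (R k) K :=
    (faithfulSMul_iff_algebraMap_injective (R k) K).2 (algebraMap_injective_R k K)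
  exact IsFractionRing.of_field (R k) K (exists_div_R k K)

end MonomialExample

/-! Membership in `R` is a family of degree conditions: kill all `X_n` and ask for degree 0 in `Z`;
for each `n`, kill `Y` and `X_i`, `i ≤ n`, and ask for degree 0 in `T_n`. Such conditions pass to
integral elements, since a polynomial integral over its coefficient domain is constant. As `A` is
integrally closed, so is `R`.

If `x` multiplies `P` into `R`, then `x` lies in `A` because `X_1` and `X_2` are coprime, and
testing on `X_(n+1)` shows that its monomials satisfy (b). Such polynomials form `R[Z]` and multiply
`P` into `P`, so `P` is strong; multiplication by `1` and `Z` detects `P`, so `P` is divisorial. If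
a divisorial `I ⊇ P` contains `f ∉ P`, additivity of `Z`-degrees modulo the `X_n` forces `(R : I) ⊆
R`, so `I = R` (`mem_R_of_mul_mem`).

A finitely generated `J ⊆ M` involves finitely many monomials, each divisible by `Y` or some `X_i`,
so `T_n` lies in `(R : J)` for large `n`. As `T_n` is not in `S`, this keeps constant terms out of
`J_v`, and `M` is a `t`-ideal. -/

namespace Polynomial

theorem natDegree_eq_zero_of_isIntegral {B : Type*} [CommRing B] [IsDomain B] {q : Polynomial B}
    (hq : IsIntegral B q) : q.natDegree = 0 := by
  obtain ⟨f, hf, hfq⟩ := hq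
  have h : f.comp q = 0 := hfq
  rcases comp_eq_zero_iff.1 h with h0 | ⟨-, h0⟩
  · exact absurd h0 hf.ne_zero
  · rw [h0, natDegree_C]

end Polynomial

/-! ### Degree in one variable after killing others. -/

namespace MvPolynomial

variable {σ k : Type*} [Field k]

open Classical in
/-- The substitution that kills the variables of `E` and records the exponent of `v` as the
degree of a polynomial in a new variable. -/
noncomputable def killHom (k : Type*) [Field k] (E : Set σ) (v : σ) :
    MvPolynomial σ k →ₐ[k] Polynomial (MvPolynomial σ k) :=
  aeval fun w => if w ∈ E then 0 else if w = v then Polynomial.X else Polynomial.C (X w)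

open Classical in
theorem killHom_monomial {E : Set σ} {v : σ} (hv : v ∉ E) {u : σ →₀ ℕ}
    (hu : ∀ w ∈ E, u w = 0) (c : k) :
    killHom k E v (monomial u c) = Polynomial.monomial (u v) (monomial (u.erase v) c) := by
  rw [killHom, aeval_monomial, ← Finsupp.mul_prod_erase' u v _ (fun _ => pow_zero _)]
  have h : ((u.erase v).prod fun i n => (if i ∈ E then 0 else if i = v then Polynomial.X
      else Polynomial.C (X i) : Polynomial (MvPolynomial σ k)) ^ n) =
      Polynomial.C ((u.erase v).prod fun i n => (X i : MvPolynomial σ k) ^ n) := by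
    rw [Finsupp.prod, Finsupp.prod, map_prod]
    refine Finset.prod_congr rfl fun i hi => ?_
    rw [Finsupp.support_erase, Finset.mem_erase, Finsupp.mem_support_iff] at hi
    rw [if_neg fun hE => hi.2 (hu i hE), if_neg hi.1, map_pow]
  rw [h, if_neg hv, if_pos rfl, monomial_eq, ← Polynomial.C_mul_X_pow_eq_monomial,
    IsScalarTower.algebraMap_apply k (MvPolynomial σ k) (Polynomial (MvPolynomial σ k)),
    algebraMap_eq, Polynomial.algebraMap_eq, map_mul]
  ring

theorem killHom_monomial_eq_zero {E : Set σ} {v : σ} {u : σ →₀ ℕ} {w : σ}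
    (hw : w ∈ E) (hu : u w ≠ 0) (c : k) : killHom k E v (monomial u c) = 0 := by
  classical
  rw [killHom, aeval_monomial, Finsupp.prod,
    Finset.prod_eq_zero (Finsupp.mem_support_iff.2 hu) (by rw [if_pos hw, zero_pow hu]), mul_zero]

open Classical in
-- Distinct monomials free of `E` have distinct images, so nothing cancels and degrees can be read
-- off the support of `p`.
theorem coeff_coeff_killHom {E : Set σ} {v : σ} (hv : v ∉ E) (p : MvPolynomial σ k) (j : ℕ)
    (m : σ →₀ ℕ) :
    ((killHom k E v p).coeff j).coeff m =
      if m v = 0 ∧ ∀ w ∈ E, m w = 0 then p.coeff (m + Finsupp.single v j) else 0 := by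
  induction p using MvPolynomial.induction_on' with
  | add p q hp hq =>
    rw [map_add, Polynomial.coeff_add, coeff_add, hp, hq, coeff_add]
    split_ifs <;> simp
  | monomial u a =>
    by_cases hu : ∀ w ∈ E, u w = 0
    · rw [killHom_monomial hv hu, Polynomial.coeff_monomial]
      have key : (u v = j ∧ u.erase v = m) ↔
          ((m v = 0 ∧ ∀ w ∈ E, m w = 0) ∧ u = m + Finsupp.single v j) := by
        constructor
        · rintro ⟨rfl, rfl⟩
          refine ⟨⟨Finsupp.erase_same, fun w hw => ?_⟩, (Finsupp.erase_add_single v u).symm⟩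
          rw [Finsupp.erase_ne (ne_of_mem_of_not_mem hw hv), hu w hw]
        · rintro ⟨⟨hm, -⟩, rfl⟩
          refine ⟨by simp [hm], ?_⟩
          rw [Finsupp.erase_add, Finsupp.erase_single, add_zero,
            Finsupp.erase_of_notMem_support (by simpa using hm)]
      simp only [apply_ite (coeff m), coeff_monomial, coeff_zero, ← ite_and]
      exact if_congr key rfl rfl
    · push Not at hu
      obtain ⟨w, hw, hne⟩ := hu
      rw [killHom_monomial_eq_zero hw hne, Polynomial.coeff_zero, coeff_zero, eq_comm, coeff_monomial]
      split_ifs with h1 h2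
      · refine absurd ?_ hne
        rw [h2, Finsupp.add_apply, h1.2 w hw,
          Finsupp.single_eq_of_ne (ne_of_mem_of_not_mem hw hv), add_zero]
      all_goals rfl

theorem natDegree_killHom_eq_zero_iff {E : Set σ} {v : σ} (hv : v ∉ E) (p : MvPolynomial σ k) :
    (killHom k E v p).natDegree = 0 ↔ ∀ m ∈ p.support, (∀ w ∈ E, m w = 0) → m v = 0 := by
  classical
  constructor
  · intro h m hm hE
    by_contra hne
    have hE' : ∀ w ∈ E, m.erase v w = 0 := fun w hw => by
      rw [Finsupp.erase_ne (ne_of_mem_of_not_mem hw hv), hE w hw]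
    have h1 := coeff_coeff_killHom hv p (m v) (m.erase v)
    rw [Polynomial.coeff_eq_zero_of_natDegree_lt (by omega), coeff_zero,
      Finsupp.erase_add_single, if_pos ⟨Finsupp.erase_same, hE'⟩] at h1
    exact (mem_support_iff.1 hm) h1.symm
  · intro h
    rw [← Nat.le_zero, Polynomial.natDegree_le_iff_coeff_eq_zero]
    intro j hj
    ext m
    rw [coeff_coeff_killHom hv, coeff_zero, ite_eq_right_iff]
    rintro ⟨hm, hE⟩
    by_contra hne
    have := h _ (mem_support_iff.2 hne) fun w hw => by
      rw [Finsupp.add_apply, hE w hw, Finsupp.single_eq_of_ne (ne_of_mem_of_not_mem hw hv), add_zero]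
    rw [Finsupp.add_apply, Finsupp.single_eq_same] at this
    omega

theorem killHom_ne_zero {E : Set σ} {v : σ} (hv : v ∉ E) {p : MvPolynomial σ k} {m : σ →₀ ℕ}
    (hm : m ∈ p.support) (hE : ∀ w ∈ E, m w = 0) : killHom k E v p ≠ 0 := by
  classical
  intro h
  have hE' : ∀ w ∈ E, m.erase v w = 0 := fun w hw => by
    rw [Finsupp.erase_ne (ne_of_mem_of_not_mem hw hv), hE w hw]
  have h1 := coeff_coeff_killHom hv p (m v) (m.erase v)
  rw [h, Polynomial.coeff_zero, coeff_zero, Finsupp.erase_add_single,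
    if_pos ⟨Finsupp.erase_same, hE'⟩] at h1
  exact (mem_support_iff.1 hm) h1.symm

/-- If a subalgebra consists of polynomials that do not involve `v` modulo the variables of `E`,
the same is true of every polynomial that is integral over it. -/
theorem natDegree_killHom_eq_zero_of_isIntegral {E : Set σ} {v : σ}
    {B : Subalgebra k (MvPolynomial σ k)} (hB : ∀ b ∈ B, (killHom k E v b).natDegree = 0)
    {p : MvPolynomial σ k} (hp : IsIntegral B p) : (killHom k E v p).natDegree = 0 := by
  -- On `B` the substitution takes constant values, so it factors through `constantCoeff`; an
  -- integral equation over `B` thus becomes one over the coefficient ring.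
  refine Polynomial.natDegree_eq_zero_of_isIntegral
    (hp.map_of_comp_eq ((Polynomial.constantCoeff.comp (killHom k E v).toRingHom).comp
      (algebraMap B (MvPolynomial σ k))) (killHom k E v).toRingHom ?_)
  ext1 b
  exact (Polynomial.eq_C_of_natDegree_eq_zero (hB b b.2)).symm

end MvPolynomial

/-! ### The ring `R` and its ideals `P` and `M`. -/

namespace MonomialExample

open MvPolynomial

section Ring

variable {k : Type*} [Field k]

theorem mem_R_iff {p : MvPolynomial Var k} : p ∈ R k ↔ ∀ m ∈ p.support, m ∈ S := Iff.rfl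

theorem mem_P_iff {p : R k} :
    p ∈ P k ↔ ∀ m ∈ (p : MvPolynomial Var k).support, ∃ n, m (Var.X n) ≠ 0 := by
  have h := mem_ideal_span_X_image (R := k) (x := (p : MvPolynomial Var k))
    (s := Set.range Var.X)
  rw [← Set.range_comp] at h
  exact h.trans (by simp)

/-- The condition (b) on a monomial. -/
def TCond (m : Var →₀ ℕ) : Prop :=
  ∀ n, m (Var.T n) ≠ 0 → m Var.Y ≠ 0 ∨ ∃ i, i ≤ n ∧ m (Var.X i) ≠ 0

/-- The variables `X_n`. -/
def varsX : Set Var := Set.range Var.X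

/-- The variables `Y` and `X_i`, `i ≤ n`. -/
def varsYX (n : ℕ+) : Set Var := insert Var.Y (Var.X '' Set.Iic n)

theorem Z_notMem_varsX : Var.Z ∉ varsX := by simp [varsX]

theorem T_notMem_varsYX (n : ℕ+) : Var.T n ∉ varsYX n := by simp [varsYX]

theorem natDegree_killHom_Z {p : MvPolynomial Var k} :
    (killHom k varsX Var.Z p).natDegree = 0 ↔
      ∀ m ∈ p.support, m Var.Z ≠ 0 → ∃ n, m (Var.X n) ≠ 0 := by
  rw [natDegree_killHom_eq_zero_iff Z_notMem_varsX]
  refine forall₂_congr fun m _ => ?_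
  rw [← not_imp_comm]
  simp [varsX]

theorem natDegree_killHom_T {n : ℕ+} {p : MvPolynomial Var k} :
    (killHom k (varsYX n) (Var.T n) p).natDegree = 0 ↔
      ∀ m ∈ p.support, m (Var.T n) ≠ 0 → m Var.Y ≠ 0 ∨ ∃ i, i ≤ n ∧ m (Var.X i) ≠ 0 := by
  rw [natDegree_killHom_eq_zero_iff (T_notMem_varsYX n)]
  refine forall₂_congr fun m _ => ?_
  rw [← not_imp_comm]
  simp [varsYX]

theorem mem_R_iff_natDegree {p : MvPolynomial Var k} : p ∈ R k ↔
    (killHom k varsX Var.Z p).natDegree = 0 ∧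
      ∀ n, (killHom k (varsYX n) (Var.T n) p).natDegree = 0 := by
  simp only [natDegree_killHom_Z, natDegree_killHom_T]
  exact ⟨fun h => ⟨fun m hm => (h m hm).1, fun n m hm => (h m hm).2 n⟩,
    fun h m hm => ⟨h.1 m hm, fun n => h.2 n m hm⟩⟩

theorem isIntegrallyClosed_R : IsIntegrallyClosed (R k) := by
  rw [isIntegrallyClosed_iff (FractionRing (MvPolynomial Var k))]
  intro x hx
  -- The polynomial ring is itself integrally closed, so `x` is a polynomial.
  obtain ⟨p, rfl⟩ := IsIntegrallyClosed.isIntegral_iff.1 (hx.tower_top (A := MvPolynomial Var k))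
  have hp : IsIntegral (R k) p := (isIntegral_algebraMap_iff
    (IsFractionRing.injective (MvPolynomial Var k) (FractionRing (MvPolynomial Var k)))).1 hx
  refine ⟨⟨p, mem_R_iff_natDegree.2 ⟨?_, fun n => ?_⟩⟩, rfl⟩
  · exact natDegree_killHom_eq_zero_of_isIntegral (fun b hb => (mem_R_iff_natDegree.1 hb).1) hp
  · exact natDegree_killHom_eq_zero_of_isIntegral (fun b hb => (mem_R_iff_natDegree.1 hb).2 n) hp

theorem X_mul_mem_R_iff {v : Var} {p : MvPolynomial Var k} :
    X v * p ∈ R k ↔ ∀ m ∈ p.support, Finsupp.single v 1 + m ∈ S := by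
  rw [mem_R_iff, support_X_mul]
  simp

theorem single_Z_add_mem_S_iff {m : Var →₀ ℕ} :
    Finsupp.single Var.Z 1 + m ∈ S ↔ (∃ n, m (Var.X n) ≠ 0) ∧ TCond m := by
  simp [S, TCond, ← AddSubmonoid.mem_carrier]

/-- A factor `Z` does not affect (b), and it makes (a) demand that some `X_n` occur. -/
theorem mem_P_iff_Z_mul_mem {p : R k} : p ∈ P k ↔ X Var.Z * (p : MvPolynomial Var k) ∈ R k := by
  rw [mem_P_iff, X_mul_mem_R_iff]
  refine forall₂_congr fun m hm => ?_
  rw [single_Z_add_mem_S_iff]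
  exact (and_iff_left (p.2 m hm).2).symm

theorem X_mem_R (n : ℕ+) : (X (Var.X n) : MvPolynomial Var k) ∈ R k := by
  rw [mem_R_iff, support_X]
  simp only [Finset.mem_singleton, forall_eq]
  exact ⟨fun _ => ⟨n, by simp⟩, fun i hi => by simp at hi⟩

theorem X_mem_P (n : ℕ+) : (⟨X (Var.X n), X_mem_R n⟩ : R k) ∈ P k := by
  rw [mem_P_iff, support_X]
  simp only [Finset.mem_singleton, forall_eq]
  exact ⟨n, by simp⟩

theorem Y_mem_R : (X Var.Y : MvPolynomial Var k) ∈ R k := by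
  rw [mem_R_iff, support_X]
  simp [S, ← AddSubmonoid.mem_carrier]

theorem Y_notMem_P : (⟨X Var.Y, Y_mem_R⟩ : R k) ∉ P k := by
  rw [mem_P_iff, support_X]
  simp

/-- Polynomials that multiply every `X_n` into `R` satisfy the condition (b). -/
theorem tCond_of_X_mul_mem {p : MvPolynomial Var k}
    (h : ∀ n, X (Var.X n) * p ∈ R k) {m : Var →₀ ℕ} (hm : m ∈ p.support) : TCond m := by
  intro n hn
  -- The index `n + 1` is too large for the extra factor to supply the required `X_i` with `i ≤ n`.
  have := (X_mul_mem_R_iff.1 (h (n + 1)) m hm).2 n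
  simp only [Finsupp.add_apply, ne_eq] at this
  rcases this (by simpa using hn) with h1 | ⟨i, hi, h1⟩
  · left; simpa using h1
  · refine Or.inr ⟨i, hi, ?_⟩
    rwa [Finsupp.single_eq_of_ne, zero_add] at h1
    rintro ⟨⟩
    exact absurd hi (not_le.2 (PNat.lt_add_right n 1))

/-- The factor from `P` brings an `X_i` into every monomial, which gives (a); condition (b) is
stable under products. -/
theorem mul_mem_R_of_tCond {p : MvPolynomial Var k} (hp : ∀ m ∈ p.support, TCond m)
    {q : R k} (hq : q ∈ P k) : p * q ∈ R k := by
  classical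
  intro m hm
  obtain ⟨a, ha, b, hb, rfl⟩ := Finset.mem_add.1 (support_mul p q hm)
  obtain ⟨i, hi⟩ := mem_P_iff.1 hq b hb
  have hbT := (q.2 b hb).2
  refine ⟨fun _ => ⟨i, by simp [hi]⟩, fun n hn => ?_⟩
  simp only [Finsupp.add_apply, ne_eq, Nat.add_eq_zero_iff] at hn ⊢
  have h1 := hp a ha n
  have h2 := hbT n
  grind

theorem mul_mem_P {p : MvPolynomial Var k} {q : R k} (hq : q ∈ P k) (h : p * q ∈ R k) :
    (⟨p * q, h⟩ : R k) ∈ P k :=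
  Ideal.mul_mem_left (Ideal.span _) p (Ideal.mem_comap.1 hq)

/-- Modulo the `X_n`, `f` is nonzero and degrees in `Z` add, so `p` cannot involve `Z` there. -/
theorem mem_R_of_mul_mem {f p : MvPolynomial Var k} (hp : ∀ m ∈ p.support, TCond m)
    (hf : f ∈ R k) (hfP : (⟨f, hf⟩ : R k) ∉ P k) (h : p * f ∈ R k) : p ∈ R k := by
  rw [mem_R_iff]
  suffices (killHom k varsX Var.Z p).natDegree = 0 from
    fun m hm => ⟨natDegree_killHom_Z.1 this m hm, hp m hm⟩
  rw [mem_P_iff] at hfP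
  push Not at hfP
  obtain ⟨m, hm, hmX⟩ := hfP
  have hf0 : killHom k varsX Var.Z f ≠ 0 :=
    killHom_ne_zero Z_notMem_varsX hm (by rintro _ ⟨n, rfl⟩; exact hmX n)
  by_cases hp0 : killHom k varsX Var.Z p = 0
  · rw [hp0, Polynomial.natDegree_zero]
  have := (mem_R_iff_natDegree.1 h).1
  rw [map_mul, Polynomial.natDegree_mul hp0 hf0] at this
  omega

theorem exists_ne_zero_of_mem_S {m : Var →₀ ℕ} (hm : m ∈ S) (h0 : m ≠ 0) :
    m Var.Y ≠ 0 ∨ ∃ i, m (Var.X i) ≠ 0 := by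
  obtain ⟨v, hv⟩ := Finsupp.ne_iff.1 h0
  rcases v with _ | _ | n | n
  · exact Or.inl hv
  · exact Or.inr (hm.1 hv)
  · exact Or.inr ⟨n, hv⟩
  · exact (hm.2 n hv).imp_right fun ⟨i, _, hi⟩ => ⟨i, hi⟩

theorem mem_M_iff {p : R k} : p ∈ M k ↔ constantCoeff (p : MvPolynomial Var k) = 0 := by
  classical
  constructor
  · intro h
    have hle : M k ≤ RingHom.ker (constantCoeff.comp (R k).val.toRingHom) := by
      refine Ideal.span_le.2 ?_
      rintro p ⟨s, -, hs0, hp⟩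
      change constantCoeff (p : MvPolynomial Var k) = 0
      rw [hp, constantCoeff_monomial, if_neg hs0]
    exact hle h
  · intro h
    have key : ∀ m : (p : MvPolynomial Var k).support, monomial m.1 (1 : k) ∈ R k := by
      intro m a ha
      rw [Finset.mem_singleton.1 (support_monomial_subset ha)]
      exact p.2 m m.2
    have hp : p = ∑ m : (p : MvPolynomial Var k).support,
        algebraMap k (R k) ((p : MvPolynomial Var k).coeff m) * ⟨monomial m.1 1, key m⟩ := by
      apply Subtype.ext
      conv_lhs => rw [(p : MvPolynomial Var k).as_sum, ← Finset.sum_coe_sort]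
      rw [AddSubmonoidClass.coe_finsetSum]
      refine Finset.sum_congr rfl fun m _ => ?_
      change _ = C _ * monomial m.1 1
      rw [C_mul_monomial, mul_one]
    rw [hp]
    refine Ideal.sum_mem _ fun m _ => Ideal.mul_mem_left _ _ (Ideal.subset_span ?_)
    refine ⟨m, p.2 m m.2, ?_, rfl⟩
    intro h0
    exact mem_support_iff.1 m.2 (by rw [h0]; exact h)

theorem isMaximal_M : (M k).IsMaximal := by
  have h : M k = RingHom.ker ((constantCoeff (R := k) (σ := Var)).comp (R k).val.toRingHom) :=
    Ideal.ext fun p => mem_M_iff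
  rw [h]
  refine RingHom.ker_isMaximal_of_surjective _ fun c => ⟨algebraMap k (R k) c, ?_⟩
  exact constantCoeff_C _ c

theorem P_lt_M : P k < M k := by
  refine lt_of_le_of_ne (fun p hp => mem_M_iff.2 ?_) fun h => Y_notMem_P (k := k) ?_
  · by_contra h
    obtain ⟨n, hn⟩ := mem_P_iff.1 hp 0 (mem_support_iff.2 h)
    exact hn rfl
  · rw [h, mem_M_iff]
    exact constantCoeff_X _ _

/-- Each of the finitely many monomials of `p` contains `Y` or some `X_i`, and then admits `T_n` for
all `n ≥ i`. -/
theorem eventually_T_mul_mem_R {p : R k} (hp : p ∈ M k) :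
    ∀ᶠ n in Filter.atTop, X (Var.T n) * (p : MvPolynomial Var k) ∈ R k := by
  simp only [X_mul_mem_R_iff]
  rw [Filter.eventually_all_finset]
  intro m hm
  have hmS := p.2 m hm
  have h0 : m ≠ 0 := by
    rintro rfl
    exact mem_support_iff.1 hm (mem_M_iff.1 hp)
  have key : ∃ N : ℕ+, ∀ n ≥ N, m Var.Y ≠ 0 ∨ ∃ i, i ≤ n ∧ m (Var.X i) ≠ 0 := by
    rcases exists_ne_zero_of_mem_S hmS h0 with h | ⟨i, hi⟩
    · exact ⟨1, fun _ _ => Or.inl h⟩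
    · exact ⟨i, fun n hn => Or.inr ⟨i, hn, hi⟩⟩
  obtain ⟨N, hN⟩ := key
  refine Filter.eventually_atTop.2 ⟨N, fun n hn => ⟨fun h => ?_, fun j hj => ?_⟩⟩
  · obtain ⟨i, hi⟩ := hmS.1 (by simpa using h)
    exact ⟨i, by simpa using hi⟩
  · by_cases hnj : n = j
    · subst hnj
      simpa using hN n hn
    · have := hmS.2 j (by simpa [Finsupp.single_apply, hnj] using hj)
      simpa using this

theorem mem_M_of_T_mul_mem_R {n : ℕ+} {p : R k} (h : X (Var.T n) * (p : MvPolynomial Var k) ∈ R k) :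
    p ∈ M k := by
  rw [mem_M_iff]
  by_contra h0
  have := (X_mul_mem_R_iff.1 h 0 (mem_support_iff.2 h0)).2 n
  simp at this

end Ring

end MonomialExample

/-! ### Generalities on `v`- and `t`-closures. -/

namespace StarOperation

variable {R : Type*} [CommRing R] [IsDomain R] {K : Type*} [Field K] [Algebra R K]
  [IsFractionRing R K]

open FractionalIdeal

/-- Division by the zero ideal gives 0 by convention, so the usual description of `1 / (1 / I)`
needs this. -/
theorem one_div_ne_zero' {I : FractionalIdeal R⁰ K} (hI : I ≠ 0) : 1 / I ≠ 0 := by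
  intro h
  have := bot_lt_mul_inv hI
  rw [inv_eq, h, mul_zero] at this
  exact lt_irrefl _ this

theorem mem_div_coeIdeal_iff {J : FractionalIdeal R⁰ K} {I : Ideal R}
    (hI : (I : FractionalIdeal R⁰ K) ≠ 0) {x : K} :
    x ∈ J / (I : FractionalIdeal R⁰ K) ↔ ∀ q ∈ I, x * algebraMap R K q ∈ J := by
  rw [mem_div_iff_of_ne_zero hI]
  refine ⟨fun h q hq => h _ (mem_coeIdeal_of_mem _ hq), fun h y hy => ?_⟩
  obtain ⟨q, hq, rfl⟩ := (mem_coeIdeal _).1 hy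
  exact h q hq

theorem mem_vClosure_iff {I : FractionalIdeal R⁰ K} (hI : I ≠ 0) {x : K} :
    x ∈ vClosure I ↔ ∀ y ∈ 1 / I, x * y ∈ (1 : FractionalIdeal R⁰ K) :=
  mem_div_iff_of_ne_zero (one_div_ne_zero' hI)

theorem le_vClosure {I : FractionalIdeal R⁰ K} (hI : I ≠ 0) : I ≤ vClosure I := by
  intro x hx
  refine (mem_vClosure_iff hI).2 fun y hy => ?_
  rw [mul_comm]
  exact (mem_div_iff_of_ne_zero hI).1 hy x hx

theorem mem_tClosure_of_mem {I : FractionalIdeal R⁰ K} (hI : I ≠ 0) {x : K} (hx : x ∈ I) :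
    x ∈ tClosure I := by
  have key : ∀ y ∈ I, y ≠ 0 → ∀ w ∈ spanSingleton R⁰ y, w ∈ tClosure I := by
    intro y hy hy0 w hw
    have hne : spanSingleton R⁰ y ≠ 0 := spanSingleton_ne_zero_iff.2 hy0
    refine ⟨spanSingleton R⁰ y, hne, ?_, spanSingleton_le_iff_mem.2 hy, le_vClosure hne hw⟩
    rw [coe_spanSingleton]
    exact Submodule.fg_span_singleton y
  -- The ideal spanned by 0 is excluded from the union, so 0 is placed in the span of some nonzero
  -- element.
  by_cases hx0 : x = 0
  · obtain ⟨y, hy0, hy⟩ : ∃ y ≠ (0 : K), y ∈ I := by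
      by_contra! h
      exact hI (eq_zero_iff.2 fun y hy => by_contra fun hy0 => h y hy0 hy)
    exact key y hy hy0 x (hx0 ▸ zero_mem _)
  · exact key x hx hx0 x (mem_spanSingleton_self _ x)

end StarOperation

/-! ### Fractional ideals of `R` in `K`. -/

namespace MonomialExample

open MvPolynomial StarOperation

variable {k : Type*} [Field k] {K : Type*} [Field K] [Algebra (MvPolynomial Var k) K]
    [IsFractionRing (MvPolynomial Var k) K]

theorem algebraMap_mem_one_iff {p : MvPolynomial Var k} :
    algebraMap (MvPolynomial Var k) K p ∈ (1 : FractionalIdeal (R k)⁰ K) ↔ p ∈ R k := by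
  rw [FractionalIdeal.mem_one_iff]
  constructor
  · rintro ⟨r, hr⟩
    rw [← IsFractionRing.injective (MvPolynomial Var k) K hr]
    exact r.2
  · exact fun h => ⟨⟨p, h⟩, rfl⟩

theorem P_ne_bot : P k ≠ ⊥ := by
  intro h
  have := X_mem_P (k := k) 1
  rw [h, Ideal.mem_bot] at this
  exact X_ne_zero (R := k) (Var.X 1) (congrArg Subtype.val this)

variable (k K) in
theorem coe_P_ne_zero : (P k : FractionalIdeal (R k)⁰ K) ≠ 0 :=
  FractionalIdeal.coeIdeal_ne_zero.2 P_ne_bot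

theorem coe_P_eq : (P k : FractionalIdeal (R k)⁰ K) =
    FractionalIdeal.spanSingleton (R k)⁰
      (algebraMap (MvPolynomial Var k) K (X Var.Z))⁻¹ ⊓ 1 := by
  have hz : algebraMap (MvPolynomial Var k) K (X Var.Z) ≠ 0 :=
    (map_ne_zero_iff _ (IsFractionRing.injective (MvPolynomial Var k) K)).2 (X_ne_zero _)
  ext x
  change _ ↔ x ∈ FractionalIdeal.spanSingleton (R k)⁰
      (algebraMap (MvPolynomial Var k) K (X Var.Z))⁻¹ ∧ x ∈ (1 : FractionalIdeal (R k)⁰ K)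
  have key : ∀ p : R k, algebraMap (R k) K p ∈ FractionalIdeal.spanSingleton (R k)⁰
      (algebraMap (MvPolynomial Var k) K (X Var.Z))⁻¹ ↔ p ∈ P k := by
    intro p
    rw [mem_P_iff_Z_mul_mem, FractionalIdeal.mem_spanSingleton,
      ← algebraMap_mem_one_iff (K := K), FractionalIdeal.mem_one_iff]
    refine exists_congr fun r => ?_
    rw [Algebra.smul_def, ← div_eq_mul_inv, div_eq_iff hz, map_mul, mul_comm]
    rfl
  constructor
  · rw [FractionalIdeal.mem_coeIdeal]
    rintro ⟨p, hp, rfl⟩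
    exact ⟨(key p).2 hp, (FractionalIdeal.mem_one_iff _).2 ⟨p, rfl⟩⟩
  · rintro ⟨hx, h1⟩
    obtain ⟨p, rfl⟩ := (FractionalIdeal.mem_one_iff _).1 h1
    exact FractionalIdeal.mem_coeIdeal_of_mem _ ((key p).1 hx)

/-- An element of `K` that multiplies every `X_n` into `R` is a polynomial. -/
theorem exists_algebraMap_eq {x : K}
    (h : ∀ n, x * algebraMap (MvPolynomial Var k) K (X (Var.X n)) ∈
      (1 : FractionalIdeal (R k)⁰ K)) :
    ∃ p, algebraMap (MvPolynomial Var k) K p = x := by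
  have hinj := IsFractionRing.injective (MvPolynomial Var k) K
  obtain ⟨a, ha⟩ := (FractionalIdeal.mem_one_iff _).1 (h 1)
  obtain ⟨b, hb⟩ := (FractionalIdeal.mem_one_iff _).1 (h 2)
  have hab : (a : MvPolynomial Var k) * X (Var.X 2) =
      (b : MvPolynomial Var k) * X (Var.X 1) := by
    apply hinj
    rw [map_mul, map_mul]
    change algebraMap (R k) K a * _ = algebraMap (R k) K b * _
    rw [ha, hb]
    ring
  -- `X_1` is prime and does not divide `X_2`, so it divides `a = x X_1`; the quotient is `x`.
  rcases (X_prime (i := Var.X 1)).dvd_or_dvd (Dvd.intro_left _ hab.symm) with ⟨p, hp⟩ | h12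
  · refine ⟨p, ?_⟩
    have h0 : algebraMap (MvPolynomial Var k) K (X (Var.X 1)) ≠ 0 :=
      (map_ne_zero_iff _ hinj).2 (X_ne_zero _)
    refine mul_right_cancel₀ h0 (Eq.trans ?_ ha)
    rw [← map_mul, mul_comm, ← hp]
    rfl
  · rw [X_dvd_X] at h12
    have h : (1 : ℕ+) = 2 := Var.X.inj h12
    exact absurd h (by decide)

omit [IsFractionRing (MvPolynomial Var k) K] in
theorem algebraMap_mk_mul {p : MvPolynomial Var k} {q : R k} (h : p * q ∈ R k) :
    algebraMap (R k) K ⟨p * q, h⟩ = algebraMap (MvPolynomial Var k) K p * algebraMap (R k) K q :=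
  map_mul (algebraMap (MvPolynomial Var k) K) p q

theorem mem_one_div_P_iff {x : K} :
    x ∈ 1 / (P k : FractionalIdeal (R k)⁰ K) ↔ ∃ p : MvPolynomial Var k,
      (∀ m ∈ p.support, TCond m) ∧ algebraMap (MvPolynomial Var k) K p = x := by
  rw [mem_div_coeIdeal_iff (coe_P_ne_zero k K)]
  constructor
  · intro h
    have hX : ∀ n, x * algebraMap (MvPolynomial Var k) K (X (Var.X n)) ∈
        (1 : FractionalIdeal (R k)⁰ K) := fun n =>
      h _ (X_mem_P n)
    obtain ⟨p, rfl⟩ := exists_algebraMap_eq hX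
    refine ⟨p, fun m hm => tCond_of_X_mul_mem (fun n => ?_) hm, rfl⟩
    rw [← algebraMap_mem_one_iff (K := K), mul_comm, map_mul]
    exact hX n
  · rintro ⟨p, hp, rfl⟩ q hq
    exact (FractionalIdeal.mem_one_iff _).2 ⟨_, algebraMap_mk_mul (mul_mem_R_of_tCond hp hq)⟩

theorem isStrong_P : IsStrong (P k : FractionalIdeal (R k)⁰ K) := by
  refine ⟨coe_P_ne_zero k K, ?_⟩
  ext x
  constructor
  · intro hx
    obtain ⟨p, hp, rfl⟩ := mem_one_div_P_iff.1 hx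
    refine (mem_div_coeIdeal_iff (coe_P_ne_zero k K)).2 fun q hq => ?_
    have h := mul_mem_R_of_tCond hp hq
    exact (FractionalIdeal.mem_coeIdeal _).2 ⟨_, mul_mem_P hq h, algebraMap_mk_mul h⟩
  · intro hx
    rw [mem_div_coeIdeal_iff (coe_P_ne_zero k K)] at hx ⊢
    exact fun q hq => FractionalIdeal.coeIdeal_le_one (hx q hq)

theorem TCond.add {a b : Var →₀ ℕ} (ha : TCond a) (hb : TCond b) : TCond (a + b) := by
  intro n hn
  have h1 := ha n
  have h2 := hb n
  simp only [Finsupp.add_apply, ne_eq, Nat.add_eq_zero_iff] at hn ⊢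
  grind

theorem erase_Z_mem_S {m : Var →₀ ℕ} (hm : TCond m) : m.erase Var.Z ∈ S := by
  refine ⟨fun h => absurd Finsupp.erase_same h, fun n hn => ?_⟩
  rw [Finsupp.erase_ne (by simp)] at hn
  rw [Finsupp.erase_ne (by simp)]
  refine (hm n hn).imp_right fun ⟨i, hi, h⟩ => ⟨i, hi, ?_⟩
  rwa [Finsupp.erase_ne (by simp)]

theorem monomial_mem_R {m : Var →₀ ℕ} (hm : m ∈ S) (c : k) : monomial m c ∈ R k := by
  classical
  intro a ha
  rwa [Finset.mem_singleton.1 (support_monomial_subset ha)]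

omit [IsFractionRing (MvPolynomial Var k) K] in
theorem mem_adjoin_Z_iff {x : K} :
    x ∈ Algebra.adjoin (R k) {algebraMap (MvPolynomial Var k) K (X Var.Z)} ↔
      ∃ p : MvPolynomial Var k,
        (∀ m ∈ p.support, TCond m) ∧ algebraMap (MvPolynomial Var k) K p = x := by
  classical
  constructor
  · intro hx
    induction hx using Algebra.adjoin_induction with
    | mem x hx =>
      refine ⟨X Var.Z, ?_, (Set.mem_singleton_iff.1 hx).symm⟩
      rw [support_X]
      simp [TCond]
    | algebraMap r => exact ⟨r, fun m hm => (r.2 m hm).2, rfl⟩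
    | add x y _ _ hx hy =>
      obtain ⟨p, hp, rfl⟩ := hx
      obtain ⟨q, hq, rfl⟩ := hy
      exact ⟨p + q, fun m hm => (Finset.mem_union.1 (support_add hm)).elim (hp m) (hq m),
        map_add _ _ _⟩
    | mul x y _ _ hx hy =>
      obtain ⟨p, hp, rfl⟩ := hx
      obtain ⟨q, hq, rfl⟩ := hy
      refine ⟨p * q, fun m hm => ?_, map_mul _ _ _⟩
      obtain ⟨a, ha, b, hb, rfl⟩ := Finset.mem_add.1 (support_mul p q hm)
      exact (hp a ha).add (hq b hb)
  · rintro ⟨p, hp, rfl⟩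
    rw [p.as_sum, map_sum]
    refine Subalgebra.sum_mem _ fun m hm => ?_
    have h : monomial m (coeff m p) =
        monomial (m.erase Var.Z) (coeff m p) * X Var.Z ^ m Var.Z := by
      rw [X_pow_eq_monomial, monomial_mul, mul_one, Finsupp.erase_add_single]
    rw [h, map_mul, map_pow]
    exact mul_mem (Subalgebra.algebraMap_mem _
      (⟨_, monomial_mem_R (erase_Z_mem_S (hp m hm)) _⟩ : R k))
      (pow_mem (Algebra.self_mem_adjoin_singleton _ _) _)

theorem coe_one_div_P : ((1 / (P k : FractionalIdeal (R k)⁰ K) : FractionalIdeal (R k)⁰ K) :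
      Submodule (R k) K) = Subalgebra.toSubmodule
    (Algebra.adjoin (R k) {algebraMap (MvPolynomial Var k) K (X Var.Z)}) :=
  Submodule.ext fun _ => mem_one_div_P_iff.trans mem_adjoin_Z_iff.symm

theorem P_ne_top : P k ≠ ⊤ := fun h => Y_notMem_P (k := k) (h ▸ Submodule.mem_top)

theorem isDivisorial_P : IsDivisorial (P k : FractionalIdeal (R k)⁰ K) := by
  refine ⟨coe_P_ne_zero k K, le_antisymm (fun x hx => ?_) (le_vClosure (coe_P_ne_zero k K))⟩
  replace hx := (mem_vClosure_iff (coe_P_ne_zero k K)).1 hx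
  have h1 := hx 1 (mem_one_div_P_iff.2 ⟨1, fun m hm => ?_, map_one _⟩)
  · rw [mul_one] at h1
    obtain ⟨p, rfl⟩ := (FractionalIdeal.mem_one_iff _).1 h1
    refine FractionalIdeal.mem_coeIdeal_of_mem _ (mem_P_iff_Z_mul_mem.2 ?_)
    rw [← algebraMap_mem_one_iff (K := K), map_mul, mul_comm]
    refine hx _ (mem_one_div_P_iff.2 ⟨X Var.Z, fun m hm => ?_, rfl⟩)
    rw [support_X, Finset.mem_singleton] at hm
    simp [hm, TCond]
  · rw [support_one, Finset.mem_singleton] at hm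
    simp [hm, TCond]

theorem isMaximalDivisorial_P : IsMaximalDivisorial K (P k) := by
  refine ⟨⟨P_ne_top, isDivisorial_P⟩, ?_⟩
  rintro I ⟨hItop, hI0, hIv⟩ hPI f hf
  by_contra hfP
  -- This suffices: it puts 1 into `I_v = I`.
  have hle : 1 / (I : FractionalIdeal (R k)⁰ K) ≤ 1 := by
    intro x hx
    have hx' := (mem_div_coeIdeal_iff hI0).1 hx
    have hxP : x ∈ 1 / (P k : FractionalIdeal (R k)⁰ K) :=
      (mem_div_coeIdeal_iff (coe_P_ne_zero k K)).2 fun q hq => hx' q (hPI hq)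
    obtain ⟨p, hp, rfl⟩ := mem_one_div_P_iff.1 hxP
    refine algebraMap_mem_one_iff.2 (mem_R_of_mul_mem hp f.2 hfP ?_)
    rw [← algebraMap_mem_one_iff (K := K), map_mul]
    exact hx' f hf
  have h1 : (1 : K) ∈ vClosure (I : FractionalIdeal (R k)⁰ K) :=
    (mem_vClosure_iff hI0).2 fun y hy => by rw [one_mul]; exact hle hy
  rw [hIv, ← map_one (algebraMap (R k) K)] at h1
  obtain ⟨p, hp, h⟩ := (FractionalIdeal.mem_coeIdeal _).1 h1
  rw [algebraMap_injective_R k K h] at hp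
  exact hItop ((Ideal.eq_top_iff_one I).2 hp)

variable (k K) in
theorem coe_M_ne_zero : (M k : FractionalIdeal (R k)⁰ K) ≠ 0 :=
  FractionalIdeal.coeIdeal_ne_zero.2 (bot_le.trans_lt P_lt_M).ne'

theorem exists_T_mem_one_div {J : FractionalIdeal (R k)⁰ K} (hJ0 : J ≠ 0)
    (hJ : (J : Submodule (R k) K).FG) (hJM : J ≤ (M k : FractionalIdeal (R k)⁰ K)) :
    ∃ n, algebraMap (MvPolynomial Var k) K (X (Var.T n)) ∈ 1 / J := by
  obtain ⟨s, hs⟩ := hJ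
  have hev : ∀ᶠ n in Filter.atTop, ∀ y ∈ s,
      algebraMap (MvPolynomial Var k) K (X (Var.T n)) * y ∈ (1 : FractionalIdeal (R k)⁰ K) := by
    rw [Filter.eventually_all_finset]
    intro y hy
    have hyJ : y ∈ (J : Submodule (R k) K) := hs ▸ Submodule.subset_span hy
    obtain ⟨p, hp, rfl⟩ := (FractionalIdeal.mem_coeIdeal _).1 (hJM hyJ)
    filter_upwards [eventually_T_mul_mem_R hp] with n hn
    rw [← algebraMap_mem_one_iff (K := K), map_mul] at hn
    exact hn
  obtain ⟨n, hn⟩ := hev.exists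
  refine ⟨n, (FractionalIdeal.mem_div_iff_of_ne_zero hJ0).2 fun y hy => ?_⟩
  rw [← FractionalIdeal.mem_coe, ← hs] at hy
  induction hy using Submodule.span_induction with
  | mem y hy => exact hn y hy
  | zero => rw [mul_zero]; exact Submodule.zero_mem _
  | add x y _ _ hx hy => rw [mul_add]; exact Submodule.add_mem _ hx hy
  | smul r y _ hy => rw [mul_smul_comm]; exact Submodule.smul_mem _ r hy

theorem isTIdeal_M : IsTIdeal (M k : FractionalIdeal (R k)⁰ K) := by
  refine ⟨coe_M_ne_zero k K, Set.Subset.antisymm ?_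
    fun x hx => mem_tClosure_of_mem (coe_M_ne_zero k K) hx⟩
  rintro x ⟨J, hJ0, hJ, hJM, hx⟩
  rw [mem_vClosure_iff hJ0] at hx
  -- Testing `x` against `1 ∈ (R : J)` gives `x ∈ R`; testing it against `T_n` below removes the
  -- constant term.
  have h1 := hx 1 ((FractionalIdeal.mem_div_iff_of_ne_zero hJ0).2 fun y hy => by
    rw [one_mul]; exact FractionalIdeal.coeIdeal_le_one (hJM hy))
  rw [mul_one] at h1
  obtain ⟨p, rfl⟩ := (FractionalIdeal.mem_one_iff _).1 h1
  obtain ⟨n, hn⟩ := exists_T_mem_one_div hJ0 hJ hJM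
  refine FractionalIdeal.mem_coeIdeal_of_mem _ (mem_M_of_T_mul_mem_R (n := n) ?_)
  rw [← algebraMap_mem_one_iff (K := K), map_mul, mul_comm]
  exact hx _ hn

theorem not_isTMaximal_P : ¬ IsTMaximal K (P k) := fun h =>
  P_lt_M.not_ge (h.2 ⟨isMaximal_M.ne_top, isTIdeal_M⟩ P_lt_M.le)

end MonomialExample

theorem mainTheorem2 (k : Type*) [Field k] (K : Type*) [Field K]
    [Algebra (MvPolynomial MonomialExample.Var k) K]
    [IsFractionRing (MvPolynomial MonomialExample.Var k) K]
    (z : K) (hz : z = algebraMap (MvPolynomial MonomialExample.Var k) K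
      (MvPolynomial.X MonomialExample.Var.Z)) :
    -- `R` is integrally closed
    IsIntegrallyClosed (MonomialExample.R k) ∧
    -- `P = R Z⁻¹ ∩ R`
    (MonomialExample.P k : FractionalIdeal (MonomialExample.R k)⁰ K) =
      FractionalIdeal.spanSingleton (MonomialExample.R k)⁰ z⁻¹ ⊓ 1 ∧
    -- `(R : P) = R[Z]`
    ((1 / (MonomialExample.P k : FractionalIdeal (MonomialExample.R k)⁰ K) :
        FractionalIdeal (MonomialExample.R k)⁰ K) : Submodule (MonomialExample.R k) K) =
      Subalgebra.toSubmodule (Algebra.adjoin (MonomialExample.R k) {z}) ∧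
    -- `P` is a strong maximal divisorial ideal
    StarOperation.IsStrong (MonomialExample.P k : FractionalIdeal (MonomialExample.R k)⁰ K) ∧
    StarOperation.IsMaximalDivisorial K (MonomialExample.P k) ∧
    -- `M = (S)R` is a maximal ideal and a `t`-ideal, and it properly contains `P`
    (MonomialExample.M k).IsMaximal ∧
    StarOperation.IsTIdeal (MonomialExample.M k : FractionalIdeal (MonomialExample.R k)⁰ K) ∧
    MonomialExample.P k < MonomialExample.M k ∧
    -- `P` is not `t`-maximal
    ¬ StarOperation.IsTMaximal K (MonomialExample.P k) := by
  subst hz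
  exact ⟨MonomialExample.isIntegrallyClosed_R, MonomialExample.coe_P_eq,
    MonomialExample.coe_one_div_P, MonomialExample.isStrong_P,
    MonomialExample.isMaximalDivisorial_P, MonomialExample.isMaximal_M,
    MonomialExample.isTIdeal_M, MonomialExample.P_lt_M, MonomialExample.not_isTMaximal_P⟩
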